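/- All graphs are finite, simple and undirected, and $d_G$ denotes the shortest-path distance. Let $G$ be a connected graph. A set $X\subseteq V(G)$ resolves two vertices $u,v$ if $d_G(u,x)\neq d_G(v,x)$ for some $x\in X$. The metric dimension $\dim(G)$ is the smallest cardinality of a set $X\subseteq V(G)$ that resolves every pair of distinct vertices of $G$, and the nonlocal metric dimension $\dim_{\mathrm{n}\ell}(G)$ is the smallest cardinality of a set $X\subseteq V(G)$ that resolves every pair of distinct non-adjacent vertices of $G$. A block of $G$ is a maximal connected subgraph that has no cut-vertex of its own; $G$ is a block graph if it is connected and each of its blocks is a complete graph. The block-cutpoint tree $\widehat{G}$ of $G$ is the tree whose vertices are the blocks and the cut-vertices of $G$, where a block $B$ is adjacent to a cut-vertex $v$ if and only if $v\in V(B)$, and there are no other edges. Theorem. If $G$ is a block graph with at least $3$ vertices, then $$\dim_{\mathrm{n}\ell}(G)=\dim(\widehat{G}).$$ -/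

import Mathlib

namespace SimpleGraph

/-- `X` resolves `u` and `v` if some `x ∈ X` has different distances to `u` and `v`. -/
def Resolves {V : Type*} (G : SimpleGraph V) (X : Finset V) (u v : V) : Prop :=
  ∃ x ∈ X, G.dist u x ≠ G.dist v x

/-- A resolving set resolves every pair of distinct vertices. -/
def IsResolvingSet {V : Type*} (G : SimpleGraph V) (X : Finset V) : Prop :=
  ∀ u v : V, u ≠ v → G.Resolves X u v

/-- A nonlocal resolving set resolves every pair of distinct non-adjacent vertices. -/
def IsNonlocalResolvingSet {V : Type*} (G : SimpleGraph V) (X : Finset V) : Prop :=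
  ∀ u v : V, u ≠ v → ¬ G.Adj u v → G.Resolves X u v

/-- The metric dimension: the smallest cardinality of a resolving set. For a finite connected
graph the set of all vertices is resolving, so the infimum is attained. -/
noncomputable def metricDim {V : Type*} (G : SimpleGraph V) : ℕ :=
  sInf {k : ℕ | ∃ X : Finset V, X.card = k ∧ G.IsResolvingSet X}

/-- The nonlocal metric dimension: the smallest cardinality of a nonlocal resolving set. -/
noncomputable def nonlocalMetricDim {V : Type*} (G : SimpleGraph V) : ℕ :=
  sInf {k : ℕ | ∃ X : Finset V, X.card = k ∧ G.IsNonlocalResolvingSet X}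

/-- A cut-vertex: its deletion separates two other vertices of the same component, that is,
it increases the number of components. -/
def IsCutVertex {V : Type*} (G : SimpleGraph V) (v : V) : Prop :=
  ∃ a b : ({v}ᶜ : Set V), G.Reachable a b ∧ ¬ (G.induce ({v}ᶜ : Set V)).Reachable a b

/-- A block: a maximal connected subgraph that has no cut-vertex of its own. Adding edges on
the same vertices destroys neither property, so blocks are induced subgraphs and are given
here by their vertex sets. -/
def IsBlock {V : Type*} (G : SimpleGraph V) (B : Set V) : Prop :=
  Maximal (fun S : Set V => (G.induce S).Connected ∧ ∀ v : S, ¬ (G.induce S).IsCutVertex v) B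

/-- A block graph: a connected graph all of whose blocks are complete. -/
def IsBlockGraph {V : Type*} (G : SimpleGraph V) : Prop :=
  G.Connected ∧ ∀ B : Set V, G.IsBlock B → G.IsClique B

/-- The block-cutpoint tree: its vertices are the blocks and the cut-vertices of `G`, and a
block `B` is adjacent to a cut-vertex `v` if `v ∈ B`. -/
def blockCutpointTree {V : Type*} (G : SimpleGraph V) :
    SimpleGraph ({B : Set V // G.IsBlock B} ⊕ {v : V // G.IsCutVertex v}) where
  Adj
    | Sum.inl B, Sum.inr v => v.1 ∈ B.1
    | Sum.inr v, Sum.inl B => v.1 ∈ B.1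
    | Sum.inl _, Sum.inl _ => False
    | Sum.inr _, Sum.inr _ => False
  symm := ⟨by rintro (_ | _) (_ | _) h <;> exact h⟩
  loopless := ⟨by rintro (_ | _) h <;> exact h⟩

end SimpleGraph

/-! Send each vertex `x` to its representative `toTree x` in the tree. In a block graph every vertex
sees a block `B` through one vertex, the gate, and the other vertices of `B` are one step farther.
Hence `treeHeight x` changes by exactly one along tree edges and descends to `toTree x`, so it is
the tree distance to `toTree x` up to an additive constant (`reachable_toTree_and_dist_add`).
Resolving the tree thus becomes a statement about distances in `G`.

By `isNonlocalResolvingSet_iff`, `X` is nonlocal resolving exactly when its representatives resolve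
the tree. Two blocks are compared through non-adjacent vertices, one in each, that avoid the gates
towards the other block; a block and a cut-vertex differ by parity; two adjacent cut-vertices are
compared through vertices one step beyond them.

Taking representatives does not enlarge a set, which gives one inequality. For the other, the only
tree vertices that represent nothing are blocks consisting of cut-vertices. Such a block has two
tree neighbours, and one of them can replace it in a resolving set
(`exists_isResolvingSet_insert_erase`). -/

namespace SimpleGraph

variable {V : Type*} {G : SimpleGraph V}

/-! ### Connected vertex sets without cut-vertices -/

/-- The property whose maximal instances are the blocks. -/
abbrev IsNonseparable (G : SimpleGraph V) (S : Set V) : Prop :=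
  (G.induce S).Connected ∧ ∀ v : S, ¬ (G.induce S).IsCutVertex v

lemma IsClique.isNonseparable {S : Set V} (hS : G.IsClique S) (hne : S.Nonempty) :
    G.IsNonseparable S := by
  have : Nonempty S := hne.to_subtype
  refine ⟨⟨fun a b => ?_⟩, ?_⟩
  · by_cases h : a = b
    · rw [h]
    · exact Adj.reachable (hS a.2 b.2 fun h' => h (Subtype.ext h'))
  · rintro v ⟨a, b, -, hab⟩
    apply hab
    by_cases h : a = b
    · rw [h]
    · exact Adj.reachable (hS a.1.2 b.1.2 fun h' => h (Subtype.ext (Subtype.ext h')))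

/-- Rotating the cycle to start at `w` and dropping both ends leaves a path through all its other
vertices. So every cycle lies in a block. -/
lemma Walk.IsCycle.isNonseparable {u : V} {c : G.Walk u u} (hc : c.IsCycle) :
    G.IsNonseparable {z | z ∈ c.support} := by
  classical
  refine ⟨c.connected_induce_support, ?_⟩
  rintro ⟨w, hw⟩ ⟨a, b, -, hab⟩
  apply hab
  have hc' := hc.rotate hw
  have hmem : ∀ z, z ∈ (c.rotate w hw).support ↔ z ∈ c.support :=
    fun z => Walk.mem_support_rotate_iff ..
  generalize c.rotate w hw = d at hc' hmem
  cases d with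
  | nil => exact absurd rfl hc'.ne_nil
  | @cons _ v _ h q =>
    have hq := ((Walk.cons_isCycle_iff _ _).1 hc').1
    have hqn : ¬ q.Nil := fun hn => h.ne hn.eq.symm
    have hsupp := Walk.support_dropLast_concat hqn
    have hnd := hq.support_nodup
    rw [← hsupp] at hnd
    have hw' : ∀ z ∈ q.dropLast.support, z ≠ w := by
      intro z hz
      simp only [List.nodup_append] at hnd
      exact hnd.2.2 z hz w (by simp)
    have hin : ∀ z, z ∈ c.support → z ≠ w → z ∈ q.dropLast.support := by
      intro z hz hzw
      rw [← hmem, Walk.support_cons, List.mem_cons, ← hsupp] at hz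
      simpa [hzw] using hz
    have hout : ∀ z, z ∈ q.dropLast.support → z ∈ c.support := by
      intro z hz
      rw [← hmem, Walk.support_cons, List.mem_cons, ← hsupp]
      simp [hz]
    let f : G.induce {z | z ∈ q.dropLast.support} →g
        (G.induce {z | z ∈ c.support}).induce ({⟨w, hw⟩}ᶜ : Set {z | z ∈ c.support}) :=
      { toFun := fun z => ⟨⟨z.1, hout z.1 z.2⟩, fun h => hw' z.1 z.2 (congrArg Subtype.val h)⟩
        map_rel' := fun h => h }
    have ha : a.1.1 ≠ w := fun h => a.2 (Subtype.ext h)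
    have hb : b.1.1 ≠ w := fun h => b.2 (Subtype.ext h)
    exact (q.dropLast.connected_induce_support.preconnected
      ⟨a.1.1, hin _ a.1.2 ha⟩ ⟨b.1.1, hin _ b.1.2 hb⟩).map f

lemma IsNonseparable.exists_isBlock_superset [Finite V] {S : Set V} (hS : G.IsNonseparable S) :
    ∃ B, S ⊆ B ∧ G.IsBlock B :=
  Finite.exists_le_maximal hS

lemma IsBlock.nonempty {B : Set V} (hB : G.IsBlock B) : B.Nonempty :=
  Set.nonempty_coe_sort.1 hB.prop.1.nonempty

lemma IsBlock.eq_of_isClique_superset {B S : Set V} (hB : G.IsBlock B) (hBS : B ⊆ S)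
    (hS : G.IsClique S) : B = S :=
  hBS.antisymm (hB.le_of_ge (hS.isNonseparable (hB.nonempty.mono hBS)) hBS)

lemma Adj.exists_isBlock [Finite V] {u v : V} (h : G.Adj u v) :
    ∃ B, G.IsBlock B ∧ u ∈ B ∧ v ∈ B := by
  have hcl : G.IsClique {u, v} := by
    rintro x (rfl | rfl) y (rfl | rfl) hxy
    · exact absurd rfl hxy
    · exact h
    · exact h.symm
    · exact absurd rfl hxy
  obtain ⟨B, hs, hB⟩ := (hcl.isNonseparable ⟨u, by simp⟩).exists_isBlock_superset
  exact ⟨B, hB, hs (by simp), hs (by simp)⟩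

/-! ### Blocks of a block graph -/

namespace IsBlockGraph

lemma isClique_support_of_isCycle [Finite V] (hG : G.IsBlockGraph) {u : V} {c : G.Walk u u}
    (hc : c.IsCycle) : G.IsClique {z | z ∈ c.support} := by
  obtain ⟨B, hSB, hB⟩ := hc.isNonseparable.exists_isBlock_superset
  exact (hG.2 B hB).subset hSB

/-- Two blocks with two common vertices coincide. -/
lemma eq_of_two_common [Finite V] (hG : G.IsBlockGraph) {B C : Set V} (hB : G.IsBlock B)
    (hC : G.IsBlock C) {u v : V} (huv : u ≠ v) (huB : u ∈ B) (hvB : v ∈ B) (huC : u ∈ C)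
    (hvC : v ∈ C) : B = C := by
  have hcB := hG.2 B hB
  have hcC := hG.2 C hC
  have key : ∀ z ∈ B, ∀ w ∈ C, z ≠ w → G.Adj z w := by
    intro z hz w hw hzw
    by_cases h1 : z = u
    · subst h1; exact hcC huC hw hzw
    by_cases h2 : z = v
    · subst h2; exact hcC hvC hw hzw
    by_cases h3 : w = u
    · subst h3; exact hcB hz huB hzw
    by_cases h4 : w = v
    · subst h4; exact hcB hz hvB hzw
    have a1 : G.Adj u z := hcB huB hz (Ne.symm h1)
    have a2 : G.Adj z v := hcB hz hvB h2
    have a3 : G.Adj v w := hcC hvC hw (Ne.symm h4)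
    have a4 : G.Adj w u := hcC hw huC h3
    -- The 4-cycle `u z v w` spans a clique, so `z` and `w` are adjacent. Then `B ∪ C` is a clique,
    -- and maximality gives `B = C`.
    have hc : (Walk.cons a1 (.cons a2 (.cons a3 (.cons a4 .nil)))).IsCycle := by
      rw [Walk.cons_isCycle_iff]
      simp [Walk.cons_isPath_iff, h1, h2, h3, hzw, huv, huv.symm, Ne.symm h1,
        Ne.symm h4]
    exact hG.isClique_support_of_isCycle hc (by simp) (by simp) hzw
  have hU : G.IsClique (B ∪ C) := by
    rintro x (hx | hx) y (hy | hy) hxy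
    · exact hcB hx hy hxy
    · exact key x hx y hy hxy
    · exact (key y hy x hx hxy.symm).symm
    · exact hcC hx hy hxy
  rw [hB.eq_of_isClique_superset Set.subset_union_left hU]
  exact (hC.eq_of_isClique_superset Set.subset_union_right hU).symm

lemma exists_adj [Nontrivial V] (hG : G.IsBlockGraph) (v : V) : ∃ w, G.Adj v w :=
  hG.1.preconnected.exists_adj_of_nontrivial v

lemma exists_isBlock_mem [Finite V] [Nontrivial V] (hG : G.IsBlockGraph) (v : V) :
    ∃ B, G.IsBlock B ∧ v ∈ B := by
  obtain ⟨w, hw⟩ := hG.exists_adj v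
  obtain ⟨B, hB, hv, -⟩ := hw.exists_isBlock
  exact ⟨B, hB, hv⟩

lemma exists_mem_ne [Finite V] [Nontrivial V] (hG : G.IsBlockGraph) {B : Set V} (hB : G.IsBlock B) (v : V) :
    ∃ w ∈ B, w ≠ v := by
  by_contra! h
  obtain ⟨b, hb⟩ := hB.nonempty
  obtain rfl := h b hb
  obtain ⟨w, hw⟩ := hG.exists_adj b
  obtain ⟨C, hC, hbC, hwC⟩ := hw.exists_isBlock
  have hBC : B ⊆ C := fun x hx => h x hx ▸ hbC
  have := hB.eq_of_isClique_superset hBC (hG.2 C hC)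
  exact hw.ne (h w (this ▸ hwC)).symm

end IsBlockGraph

/-! ### Gates

Deleting the edges inside a block `B` of a block graph puts the vertices of `B` into different
components. The gate of `z` is the vertex of `B` in the component of `z`. -/

/-- The graph `G` without the edges inside `B`. -/
def deleteInside (G : SimpleGraph V) (B : Set V) : SimpleGraph V where
  Adj a b := G.Adj a b ∧ ¬ (a ∈ B ∧ b ∈ B)
  symm := ⟨fun _ _ h => ⟨h.1.symm, fun h' => h.2 h'.symm⟩⟩
  loopless := ⟨fun _ h => h.1.ne rfl⟩

open Classical in
/-- The vertex of `B` through which `z` is attached to `B`. -/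
noncomputable def gate (G : SimpleGraph V) (B : Set V) (z : V) : V :=
  if h : ∃ g ∈ B, (G.deleteInside B).Reachable g z then h.choose else z

lemma deleteInside_le (B : Set V) : G.deleteInside B ≤ G := fun _ _ h => h.1

namespace IsBlockGraph

/-- A path from `u` to `v` without edges inside `B` closes up through the edge `vu` to a cycle. The
block of this cycle shares `u` and `v` with `B`, yet contains the second vertex of the path, which
is outside `B`. -/
lemma not_reachable_deleteInside [Finite V] (hG : G.IsBlockGraph) {B : Set V} (hB : G.IsBlock B)
    {u v : V} (hu : u ∈ B) (hv : v ∈ B) (huv : u ≠ v) : ¬ (G.deleteInside B).Reachable u v := by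
  rintro h
  obtain ⟨p, hp⟩ := h.exists_isPath
  cases p with
  | nil => exact huv rfl
  | @cons _ w _ h q =>
    have hwB : w ∉ B := fun hw => h.2 ⟨hu, hw⟩
    let q' := (Walk.cons h q).mapLe (G.deleteInside_le B)
    have hq' : q'.IsPath := hp.mapLe _
    have hadj : G.Adj v u := hG.2 B hB hv hu huv.symm
    have hc : (Walk.cons hadj q').IsCycle := by
      rw [Walk.cons_isCycle_iff]
      refine ⟨hq', fun he => ?_⟩
      rw [Walk.edges_mapLe_eq_edges] at he
      exact (Walk.adj_of_mem_edges _ he).2 ⟨hv, hu⟩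
    obtain ⟨C, hsC, hC⟩ := hc.isNonseparable.exists_isBlock_superset
    have hBC := hG.eq_of_two_common hB hC huv hu hv (hsC (by simp [q'])) (hsC (by simp))
    exact hwB (hBC ▸ hsC (by simp [q']))

section Gate

variable {B : Set V}

lemma exists_reachable_deleteInside (hG : G.IsBlockGraph) (hB : G.IsBlock B) (z : V) :
    ∃ g ∈ B, (G.deleteInside B).Reachable g z := by
  obtain ⟨b, hb⟩ := hB.nonempty
  obtain ⟨p⟩ := hG.1.preconnected z b
  induction p with
  | nil => exact ⟨_, hb, .rfl⟩
  | @cons z w _ h q ih =>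
    obtain ⟨g, hg, hr⟩ := ih hb
    by_cases hin : z ∈ B ∧ w ∈ B
    · exact ⟨z, hin.1, .rfl⟩
    · exact ⟨g, hg, hr.trans (Adj.reachable ⟨h.symm, fun h' => hin h'.symm⟩)⟩

lemma gate_mem (hG : G.IsBlockGraph) (hB : G.IsBlock B) (z : V) : G.gate B z ∈ B := by
  have h := hG.exists_reachable_deleteInside hB z
  rw [gate, dif_pos h]
  exact h.choose_spec.1

lemma gate_reachable (hG : G.IsBlockGraph) (hB : G.IsBlock B) (z : V) :
    (G.deleteInside B).Reachable (G.gate B z) z := by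
  have h := hG.exists_reachable_deleteInside hB z
  rw [gate, dif_pos h]
  exact h.choose_spec.2

variable [Finite V]

lemma gate_eq (hG : G.IsBlockGraph) (hB : G.IsBlock B) {g z : V} (hg : g ∈ B)
    (h : (G.deleteInside B).Reachable g z) : G.gate B z = g := by
  by_contra hne
  exact hG.not_reachable_deleteInside hB (hG.gate_mem hB z) hg hne
    ((hG.gate_reachable hB z).trans h.symm)

lemma gate_of_mem (hG : G.IsBlockGraph) (hB : G.IsBlock B) {b : V} (hb : b ∈ B) :
    G.gate B b = b :=
  hG.gate_eq hB hb .rfl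

lemma gate_eq_of_adj (hG : G.IsBlockGraph) (hB : G.IsBlock B) {z w : V} (h : G.Adj z w)
    (hn : ¬ (z ∈ B ∧ w ∈ B)) : G.gate B z = G.gate B w :=
  (hG.gate_eq hB (hG.gate_mem hB z) ((hG.gate_reachable hB z).trans
    (Adj.reachable ⟨h, hn⟩))).symm

/-- A walk between vertices with different gates runs through the gate of its start and uses a
further edge. -/
lemma dist_gate_lt_length (hG : G.IsBlockGraph) (hB : G.IsBlock B) {x y : V} (p : G.Walk x y)
    (h : G.gate B x ≠ G.gate B y) : G.dist (G.gate B x) x < p.length := by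
  induction p with
  | nil => exact absurd rfl h
  | @cons x w y hadj q ih =>
    by_cases hin : x ∈ B ∧ w ∈ B
    · simp [hG.gate_of_mem hB hin.1]
    · have hg := hG.gate_eq_of_adj hB hadj hin
      rw [hg] at h ⊢
      have h1 := ih h
      have h2 := hG.1.dist_triangle (u := G.gate B w) (v := w) (w := x)
      rw [dist_eq_one_iff_adj.2 hadj.symm] at h2
      rw [Walk.length_cons]
      omega

lemma dist_gate_lt (hG : G.IsBlockGraph) (hB : G.IsBlock B) {x y : V}
    (h : G.gate B x ≠ G.gate B y) : G.dist (G.gate B x) x < G.dist y x := by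
  obtain ⟨p, hp⟩ := hG.1.exists_walk_length_eq_dist x y
  rw [dist_comm (u := y), ← hp]
  exact hG.dist_gate_lt_length hB p h

lemma dist_of_mem_of_ne (hG : G.IsBlockGraph) (hB : G.IsBlock B) {x y : V} (hy : y ∈ B)
    (h : G.gate B x ≠ y) : G.dist y x = G.dist (G.gate B x) x + 1 := by
  have h1 := hG.dist_gate_lt hB (x := x) (y := y) (by rwa [hG.gate_of_mem hB hy])
  have h2 := hG.1.dist_triangle (u := y) (v := G.gate B x) (w := x)
  rw [dist_eq_one_iff_adj.2 (hG.2 B hB hy (hG.gate_mem hB x) h.symm)] at h2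
  omega

/-- A vertex that is the gate of another vertex is a cut-vertex. -/
lemma isCutVertex_gate [Nontrivial V] (hG : G.IsBlockGraph) (hB : G.IsBlock B) {x : V}
    (h : G.gate B x ≠ x) : G.IsCutVertex (G.gate B x) := by
  obtain ⟨b, hb, hbg⟩ := hG.exists_mem_ne hB (G.gate B x)
  set g := G.gate B x with hg
  refine ⟨⟨x, h.symm⟩, ⟨b, hbg⟩, hG.1.preconnected _ _, ?_⟩
  rintro ⟨p⟩
  -- A walk changes its gate only along an edge inside `B`, and the only vertex of `B` with gate `g`
  -- is `g`, which the walk avoids.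
  have key : ∀ (z w : ({g}ᶜ : Set V)) (_ : (G.induce ({g}ᶜ : Set V)).Walk z w),
      G.gate B z = g → G.gate B w = g := by
    intro z w p
    induction p with
    | nil => exact id
    | @cons z w _ hadj q ih =>
      intro hz
      apply ih
      refine Eq.trans (hG.gate_eq_of_adj hB hadj fun hin => z.2 ?_).symm hz
      exact (hG.gate_of_mem hB hin.1).symm.trans hz
  exact hbg ((hG.gate_of_mem hB hb).symm.trans (key _ _ p rfl))

/-- Seen from `x`, at most one of the blocks at `c` has a gate other than `c`. -/
lemma gate_eq_of_gate_ne (hG : G.IsBlockGraph) (hB : G.IsBlock B) {C : Set V} (hC : G.IsBlock C)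
    (hBC : B ≠ C) {c x : V} (hcB : c ∈ B) (hcC : c ∈ C) (h : G.gate B x ≠ c) :
    G.gate C x = c := by
  have hgB := hG.gate_mem hB x
  have hgC : G.gate B x ∉ C := fun hg => hBC (hG.eq_of_two_common hB hC h hgB hcB hg hcC)
  have h0 : G.gate C (G.gate B x) = c := by
    rw [hG.gate_eq_of_adj hC (hG.2 B hB hgB hcB h) (fun h' => hgC h'.1), hG.gate_of_mem hC hcC]
  -- The gate in `C` could change from `c` only on leaving `c` itself, but the gate in `B` is
  -- constant along the walk and differs from `c`.
  have key : ∀ (z w : V) (_ : (G.deleteInside B).Walk z w),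
      G.gate B z ≠ c → G.gate C z = c → G.gate C w = c := by
    intro z w p
    induction p with
    | nil => exact fun _ => id
    | @cons z w _ hadj q ih =>
      intro hz hz'
      have hzB : G.gate B z = G.gate B w := hG.gate_eq_of_adj hB hadj.1 hadj.2
      refine ih (hzB ▸ hz) (hz' ▸ (hG.gate_eq_of_adj hC hadj.1 fun hin => ?_).symm)
      rw [hG.gate_of_mem hC hin.1] at hz'
      exact hz (hz' ▸ hG.gate_of_mem hB (hz' ▸ hcB))
  obtain ⟨p⟩ := hG.gate_reachable hB x
  exact key _ _ p (by rwa [hG.gate_of_mem hB hgB]) h0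

lemma gate_eq_of_mem_block (hG : G.IsBlockGraph) (hB : G.IsBlock B) {C : Set V}
    (hC : G.IsBlock C) (hBC : B ≠ C) {y z : V} (hy : y ∈ C) (hz : z ∈ C) :
    G.gate B y = G.gate B z := by
  by_cases hyz : y = z
  · rw [hyz]
  · exact hG.gate_eq_of_adj hB (hG.2 C hC hy hz hyz) fun hin =>
      hBC (hG.eq_of_two_common hB hC hyz hin.1 hin.2 hy hz)

/-- The block of the first edge of a geodesic from `c` to `x` works: if its gate were `c`, the next
vertex would be farther from `x`. -/
lemma exists_isBlock_gate_ne (hG : G.IsBlockGraph) {c x : V} (h : c ≠ x) :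
    ∃ B, G.IsBlock B ∧ c ∈ B ∧ G.gate B x ≠ c := by
  obtain ⟨p, hp⟩ := hG.1.exists_walk_length_eq_dist c x
  cases p with
  | nil => exact absurd rfl h
  | @cons _ w _ hadj q =>
    obtain ⟨B, hB, hc, hw⟩ := hadj.exists_isBlock
    refine ⟨B, hB, hc, fun hg => ?_⟩
    have h1 := hG.dist_of_mem_of_ne hB hw (x := x) (by rw [hg]; exact hadj.ne)
    rw [hg] at h1
    have h2 := dist_le q
    rw [Walk.length_cons] at hp
    omega

/-- A vertex of two blocks is a cut-vertex. -/
lemma isCutVertex_of_mem_of_mem [Nontrivial V] (hG : G.IsBlockGraph) (hB : G.IsBlock B)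
    {C : Set V} (hC : G.IsBlock C) (hBC : B ≠ C) {v : V} (hvB : v ∈ B) (hvC : v ∈ C) :
    G.IsCutVertex v := by
  obtain ⟨c, hc, hcv⟩ := hG.exists_mem_ne hC v
  have h : G.gate B c = v :=
    (hG.gate_eq_of_mem_block hB hC hBC hc hvC).trans (hG.gate_of_mem hB hvB)
  rw [← h]
  exact hG.isCutVertex_gate hB (by rw [h]; exact hcv.symm)

/-- A cut-vertex lies in a second block. -/
lemma exists_isBlock_ne (hG : G.IsBlockGraph) (hB : G.IsBlock B) {v : V}
    (hv : G.IsCutVertex v) : ∃ C, G.IsBlock C ∧ C ≠ B ∧ v ∈ C := by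
  by_contra! hcon
  have hnb : ∀ w, G.Adj v w → w ∈ B := by
    intro w hw
    obtain ⟨C, hC, hvC, hwC⟩ := hw.exists_isBlock
    by_contra hwB
    exact hcon C hC (fun h => hwB (h ▸ hwC)) hvC
  -- All neighbours of `v` lie in the clique `B`, so a walk can bypass `v`. Strong induction is
  -- needed because a bypass consumes two edges.
  have key : ∀ (n : ℕ) (a b : V) (ha : a ≠ v) (hb : b ≠ v) (p : G.Walk a b), p.length = n →
      (G.induce ({v}ᶜ : Set V)).Reachable ⟨a, ha⟩ ⟨b, hb⟩ := by
    intro n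
    induction n using Nat.strong_induction_on with
    | _ n ih =>
      intro a b ha hb p hn
      cases p with
      | nil => exact .rfl
      | @cons _ w _ h q =>
        rw [Walk.length_cons] at hn
        by_cases hw : w = v
        · subst hw
          cases q with
          | nil => exact absurd rfl hb
          | @cons _ z _ h' r =>
            rw [Walk.length_cons] at hn
            refine Reachable.trans (v := ⟨z, h'.ne'⟩) ?_ (ih _ (by omega) z _ h'.ne' hb r rfl)
            by_cases haz : a = z
            · subst haz; rfl
            · exact Adj.reachable (hG.2 B hB (hnb a h.symm) (hnb z h') haz)
        · exact (Adj.reachable (show (G.induce ({v}ᶜ : Set V)).Adj ⟨a, ha⟩ ⟨w, hw⟩ from h)).trans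
            (ih _ (by omega) w _ hw hb q rfl)
  obtain ⟨a, b, ⟨p⟩, hab⟩ := hv
  exact hab (key _ a b a.2 b.2 p rfl)

end Gate

end IsBlockGraph

/-! ### Trees -/

section Tree

variable {W : Type*} {T : SimpleGraph W}

/-- A function with slope at most one along edges that strictly descends to `t₀` from every other
vertex measures the distance to `t₀`. -/
lemma reachable_and_dist_add_eq {f : W → ℕ} {t₀ : W} (hlip : ∀ a b, T.Adj a b → f a ≤ f b + 1)
    (hdesc : ∀ t, t ≠ t₀ → ∃ s, T.Adj t s ∧ f s + 1 = f t) (t : W) :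
    T.Reachable t t₀ ∧ T.dist t t₀ + f t₀ = f t := by
  have hwalk : ∀ {a b : W} (p : T.Walk a b), f a ≤ p.length + f b := by
    intro a b p
    induction p with
    | nil => simp
    | cons h q ih =>
      have := hlip _ _ h
      rw [Walk.length_cons]
      omega
  have hex : ∀ n t, f t = n → ∃ p : T.Walk t t₀, p.length + f t₀ = f t := by
    intro n
    induction n using Nat.strong_induction_on with
    | _ n ih =>
      intro t ht
      by_cases h : t = t₀
      · subst h; exact ⟨.nil, by simp⟩
      · obtain ⟨s, hs, hfs⟩ := hdesc t h
        obtain ⟨p, hp⟩ := ih (f s) (by omega) s rfl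
        exact ⟨.cons hs p, by rw [Walk.length_cons]; omega⟩
  obtain ⟨p, hp⟩ := hex _ t rfl
  obtain ⟨q, hq⟩ := p.reachable.exists_walk_length_eq_dist
  have h1 := dist_le p
  have h2 := hwalk q
  exact ⟨p.reachable, by omega⟩

/-- A graph is acyclic if it has a height function, injective along edges, for which every vertex
has at most one lower neighbour. -/
lemma isAcyclic_of_unique_lower {f : W → ℕ} (hne : ∀ a b, T.Adj a b → f a ≠ f b)
    (huniq : ∀ t a b, T.Adj t a → T.Adj t b → f a < f t → f b < f t → a = b) :
    T.IsAcyclic := by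
  classical
  intro u c hc
  -- A highest vertex of a cycle would have two distinct lower neighbours.
  obtain ⟨m, hm, hmax⟩ := c.support.toFinset.exists_max_image f ⟨u, by simp⟩
  rw [List.mem_toFinset] at hm
  have hc' := hc.rotate hm
  have hmem : ∀ z ∈ (c.rotate m hm).support, f z ≤ f m := fun z hz =>
    hmax z (List.mem_toFinset.2 ((Walk.mem_support_rotate_iff ..).1 hz))
  generalize c.rotate m hm = d at hc' hmem
  have h1 : T.Adj m d.snd := d.adj_snd hc'.not_nil
  have h2 : T.Adj m d.penultimate := (d.adj_penultimate hc'.not_nil).symm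
  exact hc'.snd_ne_penultimate (huniq m _ _ h1 h2
    (lt_of_le_of_ne (hmem _ (d.getVert_mem_support _)) (hne _ _ h1).symm)
    (lt_of_le_of_ne (hmem _ (d.getVert_mem_support _)) (hne _ _ h2).symm))

lemma IsTree.eq_of_closer (hT : T.IsTree) {t a b r : W} (ha : T.Adj t a) (hb : T.Adj t b)
    (hda : T.dist a r + 1 = T.dist t r) (hdb : T.dist b r + 1 = T.dist t r) : a = b := by
  obtain ⟨p, hp⟩ := hT.1.exists_walk_length_eq_dist a r
  obtain ⟨q, hq⟩ := hT.1.exists_walk_length_eq_dist b r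
  have hp' : (Walk.cons ha p).IsPath := Walk.isPath_of_length_eq_dist _ (by simp [hp, hda])
  have hq' : (Walk.cons hb q).IsPath := Walk.isPath_of_length_eq_dist _ (by simp [hq, hdb])
  have h := congrArg Subtype.val ((hT.2.subsingleton_path t r).elim ⟨_, hp'⟩ ⟨_, hq'⟩)
  simpa using congrArg Walk.snd h

/-- If `v` and `r` lie on different sides of the edge `yc`, then geodesics from `v` to `r` use
this edge. -/
lemma IsTree.dist_eq_of_sides (hT : T.IsTree) {y c v r : W} (hyc : T.Adj y c)
    (hv : T.dist v y = T.dist v c + 1) (hr : T.dist c r = T.dist y r + 1) :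
    T.dist v r = T.dist v c + 1 + T.dist y r := by
  -- The extra neighbour `s` excludes a step away from `r`: if `v` were closer to `r` than the next
  -- vertex `w`, uniqueness would make `v` that neighbour of `w`, and `v` is not closer to `y`.
  suffices h : ∀ n v, T.dist v c = n → T.dist v y = n + 1 → T.dist v r = n + 1 + T.dist y r ∧
      ∃ s, T.Adj v s ∧ T.dist s r + 1 = T.dist v r ∧ T.dist s y < T.dist v y from
    (h _ v rfl hv).1
  intro n
  induction n with
  | zero =>
    intro v hvc _
    obtain rfl := hT.1.dist_eq_zero_iff.1 hvc
    refine ⟨by omega, y, hyc.symm, by omega, ?_⟩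
    rw [dist_self]
    omega
  | succ n ih =>
    intro v hvc hvy
    obtain ⟨p, hp⟩ := hT.1.exists_walk_length_eq_dist v c
    cases p with
    | nil => simp at hvc
    | @cons _ w _ h q =>
      have h1 := dist_le q
      have h2 := hT.1.dist_triangle (u := v) (v := w) (w := y)
      have h3 := hT.1.dist_triangle (u := w) (v := c) (w := y)
      have h4 := hT.1.dist_triangle (u := v) (v := w) (w := c)
      rw [dist_eq_one_iff_adj.2 h] at h2 h4
      rw [dist_eq_one_iff_adj.2 hyc.symm] at h3
      rw [Walk.length_cons] at hp
      obtain ⟨hwr, s, hs, hsr, hsy⟩ := ih w (by omega) (by omega)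
      have h5 := hT.dist_eq_dist_add_one_of_adj r h
      rw [dist_comm, dist_comm (v := w)] at h5
      rcases h5 with h5 | h5
      · exact ⟨by omega, w, h, by omega, by omega⟩
      · obtain rfl := hT.eq_of_closer hs h.symm hsr h5.symm
        omega

/-- A vertex of a resolving set with at least two neighbours can be replaced by one of them. -/
lemma IsTree.exists_isResolvingSet_insert_erase [DecidableEq W] (hT : T.IsTree) {Y : Finset W}
    (hY : T.IsResolvingSet Y) {y c₁ c₂ : W} (h₁ : T.Adj y c₁) (h₂ : T.Adj y c₂)
    (h₁₂ : c₁ ≠ c₂) : ∃ c, T.Adj y c ∧ T.IsResolvingSet (insert c (Y.erase y)) := by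
  obtain ⟨r, hrY, hr⟩ := hY c₁ c₂ h₁₂
  have hry : r ≠ y := by
    rintro rfl
    rw [dist_eq_one_iff_adj.2 h₁.symm, dist_eq_one_iff_adj.2 h₂.symm] at hr
    exact hr rfl
  -- Distances to `r` differ by exactly one along tree edges, so the one of `c₁`, `c₂` farther from
  -- `r` lies beyond `y`.
  obtain ⟨c, hyc, hcr⟩ : ∃ c, T.Adj y c ∧ T.dist c r = T.dist y r + 1 := by
    have := h₁.diff_dist_adj (u := r)
    have := h₂.diff_dist_adj (u := r)
    have := hT.dist_ne_of_adj r h₁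
    have := hT.dist_ne_of_adj r h₂
    simp only [dist_comm (u := r)] at *
    rcases lt_or_gt_of_ne hr with h | h
    · exact ⟨c₂, h₂, by omega⟩
    · exact ⟨c₁, h₁, by omega⟩
  refine ⟨c, hyc, ?_⟩
  -- If `c` fails, then `v` lies on the side of `c` and `r` on the side of `y`. So `dist v r = dist
  -- v y + dist y r`, which exceeds `dist u r`, and `r` succeeds.
  have key : ∀ u v, T.dist u y < T.dist v y → T.Resolves (insert c (Y.erase y)) u v := by
    intro u v hlt
    by_contra hcon
    simp only [Resolves, not_exists, not_and, not_not] at hcon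
    have hc := hcon c (Finset.mem_insert_self _ _)
    have hr' := hcon r (Finset.mem_insert_of_mem (Finset.mem_erase.2 ⟨hry, hrY⟩))
    have e1 := hyc.diff_dist_adj (u := u)
    have e2 := hyc.diff_dist_adj (u := v)
    have n1 := hT.dist_ne_of_adj u hyc
    have n2 := hT.dist_ne_of_adj v hyc
    have hs := hT.dist_eq_of_sides hyc (v := v) (r := r) (by omega) hcr
    have ht := hT.1.dist_triangle (u := u) (v := y) (w := r)
    omega
  intro u v huv
  obtain ⟨x, hx, hxd⟩ := hY u v huv
  by_cases hxy : x = y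
  · subst hxy
    rcases lt_or_gt_of_ne hxd with h | h
    · exact key u v h
    · obtain ⟨w, hw, hwd⟩ := key v u h
      exact ⟨w, hw, hwd.symm⟩
  · exact ⟨x, Finset.mem_insert_of_mem (Finset.mem_erase.2 ⟨hxy, hx⟩), hxd⟩

end Tree

lemma IsResolvingSet.metricDim_le {X : Finset V} (hX : G.IsResolvingSet X) :
    G.metricDim ≤ X.card :=
  Nat.sInf_le ⟨X, rfl, hX⟩

lemma IsNonlocalResolvingSet.nonlocalMetricDim_le {X : Finset V}
    (hX : G.IsNonlocalResolvingSet X) : G.nonlocalMetricDim ≤ X.card :=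
  Nat.sInf_le ⟨X, rfl, hX⟩

/-! ### Distances in the block-cutpoint tree -/

/-- The height of a vertex of the block-cutpoint tree over the vertex `x` of the graph: twice the
distance for a cut-vertex, twice the distance plus one for a block. -/
noncomputable def treeHeight (G : SimpleGraph V) (x : V) :
    {B : Set V // G.IsBlock B} ⊕ {v : V // G.IsCutVertex v} → ℕ
  | Sum.inl B => 2 * G.dist (G.gate B.1 x) x + 1
  | Sum.inr c => 2 * G.dist c.1 x

namespace IsBlockGraph

variable [Finite V]

open Classical in
/-- The vertex of the block-cutpoint tree that represents `v`: a cut-vertex represents itself, any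
other vertex is represented by its block. -/
noncomputable def toTree [Nontrivial V] (hG : G.IsBlockGraph) (v : V) :
    {B : Set V // G.IsBlock B} ⊕ {v : V // G.IsCutVertex v} :=
  if h : G.IsCutVertex v then Sum.inr ⟨v, h⟩
  else Sum.inl ⟨(hG.exists_isBlock_mem v).choose, (hG.exists_isBlock_mem v).choose_spec.1⟩

lemma toTree_of_isCutVertex [Nontrivial V] (hG : G.IsBlockGraph) {v : V} (h : G.IsCutVertex v) :
    hG.toTree v = Sum.inr ⟨v, h⟩ :=
  dif_pos h

lemma toTree_of_not_isCutVertex [Nontrivial V] (hG : G.IsBlockGraph) {v : V}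
    (h : ¬ G.IsCutVertex v) {B : Set V} (hB : G.IsBlock B) (hv : v ∈ B) :
    hG.toTree v = Sum.inl ⟨B, hB⟩ := by
  have hs := (hG.exists_isBlock_mem v).choose_spec
  rw [toTree, dif_neg h]
  congr 2
  by_contra hne
  exact h (hG.isCutVertex_of_mem_of_mem hs.1 hB hne hs.2 hv)

lemma treeHeight_inr_of_mem (hG : G.IsBlockGraph) (x : V) {B : {B : Set V // G.IsBlock B}}
    {c : {v : V // G.IsCutVertex v}} (hc : c.1 ∈ B.1) :
    (G.gate B.1 x = c.1 → G.treeHeight x (Sum.inr c) + 1 = G.treeHeight x (Sum.inl B)) ∧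
    (G.gate B.1 x ≠ c.1 → G.treeHeight x (Sum.inr c) = G.treeHeight x (Sum.inl B) + 1) := by
  refine ⟨fun h => ?_, fun h => ?_⟩
  · simp only [treeHeight, h]
  · simp only [treeHeight, hG.dist_of_mem_of_ne B.2 hc h]
    omega

lemma treeHeight_adj (hG : G.IsBlockGraph) (x : V)
    {s t : {B : Set V // G.IsBlock B} ⊕ {v : V // G.IsCutVertex v}}
    (h : G.blockCutpointTree.Adj s t) :
    G.treeHeight x s = G.treeHeight x t + 1 ∨ G.treeHeight x s + 1 = G.treeHeight x t := by
  match s, t, h with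
  | Sum.inl B, Sum.inr c, h =>
    have := hG.treeHeight_inr_of_mem x (B := B) (c := c) h
    by_cases hg : G.gate B.1 x = c.1
    · exact .inl (this.1 hg).symm
    · exact .inr (this.2 hg).symm
  | Sum.inr c, Sum.inl B, h =>
    have := hG.treeHeight_inr_of_mem x (B := B) (c := c) h
    by_cases hg : G.gate B.1 x = c.1
    · exact .inr (this.1 hg)
    · exact .inl (this.2 hg)

variable [Nontrivial V]

/-- Descent goes from a block to its gate, and from a cut-vertex `c ≠ x` to the block at `c` that
faces `x`. -/
lemma reachable_toTree_and_dist_add (hG : G.IsBlockGraph) (x : V)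
    (t : {B : Set V // G.IsBlock B} ⊕ {v : V // G.IsCutVertex v}) :
    G.blockCutpointTree.Reachable t (hG.toTree x) ∧
      G.blockCutpointTree.dist t (hG.toTree x) + G.treeHeight x (hG.toTree x) =
        G.treeHeight x t := by
  refine reachable_and_dist_add_eq (fun a b h => ?_) (fun t ht => ?_) t
  · have := hG.treeHeight_adj x h
    omega
  · match t, ht with
    | Sum.inl B, ht =>
      have hg : G.IsCutVertex (G.gate B.1 x) := by
        by_cases hx : G.gate B.1 x = x
        · rw [hx]
          by_contra hcut
          have hxB : x ∈ B.1 := hx ▸ hG.gate_mem B.2 x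
          exact ht (hG.toTree_of_not_isCutVertex hcut B.2 hxB).symm
        · exact hG.isCutVertex_gate B.2 hx
      exact ⟨Sum.inr ⟨_, hg⟩, hG.gate_mem B.2 x,
        (hG.treeHeight_inr_of_mem x (hG.gate_mem B.2 x) (c := ⟨_, hg⟩)).1 rfl⟩
    | Sum.inr c, ht =>
      have hcx : c.1 ≠ x := by
        rintro rfl
        exact ht (hG.toTree_of_isCutVertex c.2).symm
      obtain ⟨B, hB, hc, hg⟩ := hG.exists_isBlock_gate_ne hcx
      exact ⟨Sum.inl ⟨B, hB⟩, hc, ((hG.treeHeight_inr_of_mem x (B := ⟨B, hB⟩) hc).2 hg).symm⟩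

/-- A vertex `x` resolves two vertices of the tree if and only if their heights over `x`
differ. -/
lemma dist_toTree_eq_iff (hG : G.IsBlockGraph) (x : V)
    (s t : {B : Set V // G.IsBlock B} ⊕ {v : V // G.IsCutVertex v}) :
    G.blockCutpointTree.dist s (hG.toTree x) = G.blockCutpointTree.dist t (hG.toTree x) ↔
      G.treeHeight x s = G.treeHeight x t := by
  have h1 := (hG.reachable_toTree_and_dist_add x s).2
  have h2 := (hG.reachable_toTree_and_dist_add x t).2
  omega

/-- Below a block there is only its gate; below a cut-vertex there is only the block facing `x`, by
`gate_eq_of_gate_ne`. -/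
lemma isTree_blockCutpointTree (hG : G.IsBlockGraph) : G.blockCutpointTree.IsTree := by
  obtain ⟨x⟩ := hG.1.nonempty
  refine ⟨?_, ?_⟩
  · have : Nonempty ({B : Set V // G.IsBlock B} ⊕ {v : V // G.IsCutVertex v}) := ⟨hG.toTree x⟩
    exact ⟨fun s t => (hG.reachable_toTree_and_dist_add x s).1.trans
      (hG.reachable_toTree_and_dist_add x t).1.symm⟩
  · refine isAcyclic_of_unique_lower (f := G.treeHeight x) (fun a b h => ?_) ?_
    · have := hG.treeHeight_adj x h
      omega
    · intro t a b hta htb ha hb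
      match t, a, b, hta, htb with
      | Sum.inl B, Sum.inr c, Sum.inr d, hc, hd =>
        have key : ∀ e : {v : V // G.IsCutVertex v}, e.1 ∈ B.1 →
            G.treeHeight x (Sum.inr e) < G.treeHeight x (Sum.inl B) → G.gate B.1 x = e.1 := by
          intro e he hlt
          by_contra hg
          have := (hG.treeHeight_inr_of_mem x he).2 hg
          omega
        exact congrArg Sum.inr (Subtype.ext ((key c hc ha).symm.trans (key d hd hb)))
      | Sum.inr c, Sum.inl B, Sum.inl C, hB, hC =>
        have key : ∀ D : {B : Set V // G.IsBlock B}, c.1 ∈ D.1 →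
            G.treeHeight x (Sum.inl D) < G.treeHeight x (Sum.inr c) → G.gate D.1 x ≠ c.1 := by
          intro D hD hlt hg
          have := (hG.treeHeight_inr_of_mem x hD).1 hg
          omega
        by_contra hne
        have hBC : B.1 ≠ C.1 := fun h => hne (congrArg Sum.inl (Subtype.ext h))
        exact key C hC hb (hG.gate_eq_of_gate_ne B.2 C.2 hBC hB hC (key B hB ha))

/-! ### Resolving sets -/

/-- Such a `u` is not the gate of `x`, hence one step farther than the gate. For `u = x` the height
is 1 and the formula fails. -/
lemma treeHeight_toTree_of_not_isCutVertex (hG : G.IsBlockGraph) {u x : V}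
    (hu : ¬ G.IsCutVertex u) (hux : u ≠ x) :
    G.treeHeight x (hG.toTree u) + 1 = 2 * G.dist u x := by
  obtain ⟨B, hB, huB⟩ := hG.exists_isBlock_mem u
  rw [hG.toTree_of_not_isCutVertex hu hB huB]
  have hg : G.gate B x ≠ u := by
    intro hg
    exact hu (hg ▸ hG.isCutVertex_gate hB (by rw [hg]; exact hux))
  rw [hG.dist_of_mem_of_ne hB huB hg]
  rfl

lemma treeHeight_toTree_of_isCutVertex (hG : G.IsBlockGraph) {u : V} (hu : G.IsCutVertex u)
    (x : V) : G.treeHeight x (hG.toTree u) = 2 * G.dist u x := by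
  rw [hG.toTree_of_isCutVertex hu]
  rfl

/-- A set of vertices whose representatives resolve the tree is a nonlocal resolving set. -/
lemma isNonlocalResolvingSet_of_tree (hG : G.IsBlockGraph) {X : Finset V}
    (hX : ∀ s t, s ≠ t → ∃ x ∈ X, G.treeHeight x s ≠ G.treeHeight x t) :
    G.IsNonlocalResolvingSet X := by
  intro u v huv hadj
  by_contra hcon
  simp only [Resolves, not_exists, not_and, not_not] at hcon
  have hne : ∀ x ∈ X, u ≠ x ∧ v ≠ x := by
    refine fun x hx => ⟨?_, ?_⟩
    · rintro rfl
      have := hcon u hx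
      rw [dist_self] at this
      exact huv (hG.1.dist_eq_zero_iff.1 this.symm).symm
    · rintro rfl
      have := hcon v hx
      rw [dist_self] at this
      exact huv (hG.1.dist_eq_zero_iff.1 this)
  -- Parity makes it useless to compare `u` with the block of `v`. Instead the block `B` at `u`
  -- facing `v` is compared with the block of `v`; equal distances to `x` force `B` to face `x` as
  -- well, so both blocks have height `2 * dist u x - 1`.
  have mixed : ∀ u v : V, ¬ G.Adj u v → u ≠ v → G.IsCutVertex u → ¬ G.IsCutVertex v →
      (∀ x ∈ X, G.dist u x = G.dist v x) → (∀ x ∈ X, v ≠ x) → False := by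
    intro u v hadj huv hu hv hcon hne
    obtain ⟨B, hB, huB, hg⟩ := hG.exists_isBlock_gate_ne huv
    have hvB : v ∉ B := fun h => hadj (hG.2 B hB huB h huv)
    have hBv : Sum.inl ⟨B, hB⟩ ≠ hG.toTree v := by
      obtain ⟨C, hC, hvC⟩ := hG.exists_isBlock_mem v
      rw [hG.toTree_of_not_isCutVertex hv hC hvC]
      intro h
      have : B = C := congrArg Subtype.val (Sum.inl_injective h)
      exact hvB (this ▸ hvC)
    obtain ⟨x, hx, hxd⟩ := hX _ _ hBv
    have h1 := hG.treeHeight_toTree_of_not_isCutVertex hv (hne x hx)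
    have h2 : G.gate B x ≠ u := by
      intro h
      have := hG.dist_gate_lt hB (x := x) (y := v) (by rw [h]; exact hg.symm)
      rw [h, hcon x hx] at this
      exact lt_irrefl _ this
    have h3 := (hG.treeHeight_inr_of_mem x (B := ⟨B, hB⟩) (c := ⟨u, hu⟩) huB).2 h2
    have h4 : G.treeHeight x (Sum.inr ⟨u, hu⟩) = 2 * G.dist u x := rfl
    have h5 := hcon x hx
    omega
  by_cases hu : G.IsCutVertex u <;> by_cases hv : G.IsCutVertex v
  · have hT : hG.toTree u ≠ hG.toTree v := by
      rw [hG.toTree_of_isCutVertex hu, hG.toTree_of_isCutVertex hv]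
      exact fun h => huv (congrArg Subtype.val (Sum.inr_injective h))
    obtain ⟨x, hx, hxd⟩ := hX _ _ hT
    rw [hG.treeHeight_toTree_of_isCutVertex hu, hG.treeHeight_toTree_of_isCutVertex hv,
      hcon x hx] at hxd
    exact hxd rfl
  · exact mixed u v hadj huv hu hv hcon fun x hx => (hne x hx).2
  · exact mixed v u (fun h => hadj h.symm) huv.symm hv hu (fun x hx => (hcon x hx).symm)
      fun x hx => (hne x hx).1
  · have hT : hG.toTree u ≠ hG.toTree v := by
      obtain ⟨B, hB, huB⟩ := hG.exists_isBlock_mem u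
      obtain ⟨C, hC, hvC⟩ := hG.exists_isBlock_mem v
      rw [hG.toTree_of_not_isCutVertex hu hB huB, hG.toTree_of_not_isCutVertex hv hC hvC]
      intro h
      have hBC : B = C := congrArg Subtype.val (Sum.inl_injective h)
      exact hadj (hG.2 C hC (hBC ▸ huB) hvC huv)
    obtain ⟨x, hx, hxd⟩ := hX _ _ hT
    have h1 := hG.treeHeight_toTree_of_not_isCutVertex hu (hne x hx).1
    have h2 := hG.treeHeight_toTree_of_not_isCutVertex hv (hne x hx).2
    have h3 := hcon x hx
    omega

/-- A nonlocal resolving set distinguishes any two blocks by their heights. -/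
lemma exists_treeHeight_inl_ne (hG : G.IsBlockGraph) {X : Finset V}
    (hX : G.IsNonlocalResolvingSet X) {B C : {B : Set V // G.IsBlock B}} (hBC : B ≠ C) :
    ∃ x ∈ X, G.treeHeight x (Sum.inl B) ≠ G.treeHeight x (Sum.inl C) := by
  have hBC' : B.1 ≠ C.1 := fun h => hBC (Subtype.ext h)
  obtain ⟨b₀, hb₀⟩ := B.2.nonempty
  obtain ⟨c₀, hc₀⟩ := C.2.nonempty
  obtain ⟨b, hb, hbg⟩ := hG.exists_mem_ne B.2 (G.gate B.1 c₀)
  obtain ⟨c, hc, hcg⟩ := hG.exists_mem_ne C.2 (G.gate C.1 b₀)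
  have hgB : ∀ y ∈ C.1, G.gate B.1 y ≠ b := fun y hy h =>
    hbg (h.symm.trans (hG.gate_eq_of_mem_block B.2 C.2 hBC' hy hc₀))
  have hgC : ∀ y ∈ B.1, G.gate C.1 y ≠ c := fun y hy h =>
    hcg (h.symm.trans (hG.gate_eq_of_mem_block C.2 B.2 hBC'.symm hy hb₀))
  have hbc : b ≠ c := by
    rintro rfl
    exact hgB b hc (hG.gate_of_mem B.2 hb)
  have hadj : ¬ G.Adj b c := by
    intro h
    by_cases hcB : c ∈ B.1
    · exact hgC c hcB (hG.gate_of_mem C.2 hc)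
    · have := hG.gate_eq_of_adj B.2 h fun h' => hcB h'.2
      rw [hG.gate_of_mem B.2 hb] at this
      exact hgB c hc this.symm
  obtain ⟨x, hx, hxd⟩ := hX b c hbc hadj
  refine ⟨x, hx, fun heq => hxd ?_⟩
  have heq' : G.dist (G.gate B.1 x) x = G.dist (G.gate C.1 x) x := by
    simp only [treeHeight] at heq
    omega
  -- If `b` were the gate of `x`, the gate of `x` in `C` would be strictly farther from `x`, against
  -- equal heights.
  have key : ∀ {B C : {B : Set V // G.IsBlock B}} {b : V}, b ∈ B.1 →
      (∀ y ∈ C.1, G.gate B.1 y ≠ b) → G.dist (G.gate B.1 x) x = G.dist (G.gate C.1 x) x →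
      G.dist b x = G.dist (G.gate B.1 x) x + 1 := by
    intro B C b hb hgB heq
    refine hG.dist_of_mem_of_ne B.2 hb fun h => ?_
    have := hG.dist_gate_lt B.2 (x := x) (y := G.gate C.1 x)
      (by rw [h]; exact (hgB _ (hG.gate_mem C.2 x)).symm)
    omega
  rw [key hb hgB heq', key hc hgC heq'.symm, heq']

lemma exists_treeHeight_ne (hG : G.IsBlockGraph) {X : Finset V}
    (hX : G.IsNonlocalResolvingSet X)
    {s t : {B : Set V // G.IsBlock B} ⊕ {v : V // G.IsCutVertex v}} (hst : s ≠ t) :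
    ∃ x ∈ X, G.treeHeight x s ≠ G.treeHeight x t := by
  have mixed : ∀ (B : {B : Set V // G.IsBlock B}) (c : {v : V // G.IsCutVertex v}),
      ∃ x ∈ X, G.treeHeight x (Sum.inl B) ≠ G.treeHeight x (Sum.inr c) := by
    intro B c
    -- By parity any `x` works; a second block at `c` serves only to show that `X` is nonempty.
    obtain ⟨C, hC, hCB, -⟩ := hG.exists_isBlock_ne B.2 c.2
    obtain ⟨x, hx, -⟩ := hG.exists_treeHeight_inl_ne hX (B := ⟨C, hC⟩) (C := B)
      fun h => hCB (congrArg Subtype.val h)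
    refine ⟨x, hx, ?_⟩
    simp only [treeHeight]
    omega
  match s, t, hst with
  | Sum.inl B, Sum.inl C, hst => exact hG.exists_treeHeight_inl_ne hX fun h => hst (h ▸ rfl)
  | Sum.inl B, Sum.inr c, _ => exact mixed B c
  | Sum.inr c, Sum.inl B, _ =>
    obtain ⟨x, hx, hxd⟩ := mixed B c
    exact ⟨x, hx, hxd.symm⟩
  | Sum.inr c, Sum.inr d, hst =>
    have hcd : c.1 ≠ d.1 := fun h => hst (congrArg Sum.inr (Subtype.ext h))
    by_contra! hcon
    have hdist : ∀ x ∈ X, G.dist c.1 x = G.dist d.1 x := by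
      intro x hx
      have := hcon x hx
      simp only [treeHeight] at this
      omega
    by_cases hadj : G.Adj c.1 d.1
    · obtain ⟨B, hB, hcB, hdB⟩ := hadj.exists_isBlock
      -- Adjacent `c` and `d` need not be resolved by `X` directly, so each is pushed one step out
      -- of `B`; the resulting vertices have different gates and are not adjacent.
      have far : ∀ c d : V, c ∈ B → d ∈ B → c ≠ d → G.IsCutVertex c →
          (∀ x ∈ X, G.dist c x = G.dist d x) →
          ∃ z, z ∉ B ∧ G.gate B z = c ∧ ∀ x ∈ X, G.dist z x = G.dist c x + 1 := by
        intro c d hc hd hcd hcut hdist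
        obtain ⟨C, hC, hCB, hcC⟩ := hG.exists_isBlock_ne hB hcut
        obtain ⟨z, hz, hzc⟩ := hG.exists_mem_ne hC c
        refine ⟨z, fun hzB => hCB (hG.eq_of_two_common hC hB hzc hz hcC hzB hc), ?_, ?_⟩
        · rw [hG.gate_eq_of_mem_block hB hC hCB.symm hz hcC, hG.gate_of_mem hB hc]
        · intro x hx
          have hgB : G.gate B x ≠ c := by
            intro h
            have := hG.dist_of_mem_of_ne hB hd (x := x) (by rwa [h])
            rw [h, hdist x hx] at this
            omega
          have hgC := hG.gate_eq_of_gate_ne hB hC hCB.symm hc hcC hgB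
          rw [hG.dist_of_mem_of_ne hC hz (x := x) (by rw [hgC]; exact hzc.symm), hgC]
      obtain ⟨z, hzB, hzg, hzd⟩ := far c.1 d.1 hcB hdB hcd c.2 hdist
      obtain ⟨w, hwB, hwg, hwd⟩ := far d.1 c.1 hdB hcB hcd.symm d.2
        fun x hx => (hdist x hx).symm
      obtain ⟨x, hx, hxd⟩ := hX z w (fun h => hcd (by rw [← hzg, h, hwg])) fun h =>
        hcd (by rw [← hzg, hG.gate_eq_of_adj hB h fun h' => hzB h'.1, hwg])
      exact hxd (by rw [hzd x hx, hwd x hx, hdist x hx])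
    · obtain ⟨x, hx, hxd⟩ := hX c.1 d.1 hcd hadj
      exact hxd (hdist x hx)

/-- A set of vertices is a nonlocal resolving set if and only if its representatives resolve the
block-cutpoint tree. -/
theorem isNonlocalResolvingSet_iff
    [DecidableEq ({B : Set V // G.IsBlock B} ⊕ {v : V // G.IsCutVertex v})]
    (hG : G.IsBlockGraph) (X : Finset V) :
    G.IsNonlocalResolvingSet X ↔ G.blockCutpointTree.IsResolvingSet (X.image hG.toTree) := by
  have h : G.blockCutpointTree.IsResolvingSet (X.image hG.toTree) ↔
      ∀ s t, s ≠ t → ∃ x ∈ X, G.treeHeight x s ≠ G.treeHeight x t := by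
    simp only [IsResolvingSet, Resolves, Finset.exists_mem_image, ne_eq, hG.dist_toTree_eq_iff]
  rw [h]
  exact ⟨fun hX s t hst => hG.exists_treeHeight_ne hX hst, hG.isNonlocalResolvingSet_of_tree⟩

/-- Every resolving set of the tree can be replaced by one that consists of representatives of
vertices. -/
lemma exists_isResolvingSet_subset_range (hG : G.IsBlockGraph)
    {Y : Finset ({B : Set V // G.IsBlock B} ⊕ {v : V // G.IsCutVertex v})}
    (hY : G.blockCutpointTree.IsResolvingSet Y) :
    ∃ Z : Finset ({B : Set V // G.IsBlock B} ⊕ {v : V // G.IsCutVertex v}),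
      G.blockCutpointTree.IsResolvingSet Z ∧ Z.card ≤ Y.card ∧
        ∀ t ∈ Z, t ∈ Set.range hG.toTree := by
  classical
  induction hn : (Y.filter (· ∉ Set.range hG.toTree)).card using Nat.strong_induction_on
    generalizing Y with
  | _ n ih =>
    by_cases hall : ∀ t ∈ Y, t ∈ Set.range hG.toTree
    · exact ⟨Y, hY, le_rfl, hall⟩
    push Not at hall
    obtain ⟨y, hyY, hy⟩ := hall
    match y, hyY, hy with
    | Sum.inr c, _, hy => exact absurd ⟨c.1, hG.toTree_of_isCutVertex c.2⟩ hy
    | Sum.inl B, hyY, hy =>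
      have hcut : ∀ v ∈ B.1, G.IsCutVertex v := by
        intro v hv
        by_contra h
        exact hy ⟨v, hG.toTree_of_not_isCutVertex h B.2 hv⟩
      obtain ⟨a, ha⟩ := B.2.nonempty
      obtain ⟨b, hb, hba⟩ := hG.exists_mem_ne B.2 a
      obtain ⟨c, hBc, hc⟩ := hG.isTree_blockCutpointTree.exists_isResolvingSet_insert_erase hY
        (y := Sum.inl B) (c₁ := Sum.inr ⟨a, hcut a ha⟩) (c₂ := Sum.inr ⟨b, hcut b hb⟩) ha hb
        (fun h => hba (congrArg Subtype.val (Sum.inr_injective h)).symm)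
      have hcr : c ∈ Set.range hG.toTree := by
        match c, hBc with
        | Sum.inr c, _ => exact ⟨c.1, hG.toTree_of_isCutVertex c.2⟩
      have hlt : ((insert c (Y.erase (Sum.inl B))).filter (· ∉ Set.range hG.toTree)).card < n := by
        rw [Finset.filter_insert, if_neg (not_not.2 hcr), Finset.filter_erase, ← hn]
        exact Finset.card_erase_lt_of_mem (Finset.mem_filter.2 ⟨hyY, hy⟩)
      obtain ⟨Z, hZ, hcard, hZr⟩ := ih _ hlt hc rfl
      refine ⟨Z, hZ, hcard.trans ((Finset.card_insert_le _ _).trans ?_), hZr⟩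
      rw [Finset.card_erase_add_one hyY]

end IsBlockGraph

end SimpleGraph

theorem mainTheorem2 {V : Type*} [Fintype V] (G : SimpleGraph V)
    (hG : G.IsBlockGraph) (hn : 3 ≤ Fintype.card V) :
    G.nonlocalMetricDim = G.blockCutpointTree.metricDim := by
  classical
  have : Nontrivial V := Fintype.one_lt_card_iff_nontrivial.1 (by omega)
  -- Nonemptiness ensures that the infimum is attained and is not the default value 0.
  have hne : {k : ℕ | ∃ X : Finset V, X.card = k ∧ G.IsNonlocalResolvingSet X}.Nonempty := by
    refine ⟨_, Finset.univ, rfl, fun u v huv _ => ⟨u, Finset.mem_univ u, ?_⟩⟩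
    rw [SimpleGraph.dist_self]
    exact (hG.1.pos_dist_of_ne huv.symm).ne
  obtain ⟨X, hXc, hX⟩ := Nat.sInf_mem hne
  rw [hG.isNonlocalResolvingSet_iff] at hX
  apply le_antisymm
  · obtain ⟨Y, hYc, hY⟩ := Nat.sInf_mem (s := {k : ℕ | ∃ Y, Y.card = k ∧
      G.blockCutpointTree.IsResolvingSet Y}) ⟨_, _, rfl, hX⟩
    obtain ⟨Z, hZ, hZY, hZr⟩ := hG.exists_isResolvingSet_subset_range hY
    choose! g hg using hZr
    have himage : (Z.image g).image hG.toTree = Z := by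
      rw [Finset.image_image]
      exact (Finset.image_congr fun t ht => hg t ht).trans Finset.image_id
    have hgZ : G.IsNonlocalResolvingSet (Z.image g) := by
      rwa [hG.isNonlocalResolvingSet_iff, himage]
    refine hgZ.nonlocalMetricDim_le.trans ?_
    exact Finset.card_image_le.trans (hZY.trans hYc.le)
  · refine hX.metricDim_le.trans ?_
    exact Finset.card_image_le.trans hXc.le
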